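/- **Setting.** Let $\mathcal L$ be a countable first-order signature. The formulae of approximate measure logic (AML) are built from the atomic $\mathcal L$-formulae by $\neg$, $\wedge$, $\exists x$, $\forall x$ and the measure constructors $m_{\vec x}<q.\,\varphi$ and $m_{\vec x}\le q.\,\varphi$, which bind a nonempty tuple $\vec x$ of distinct variables, for rationals $q\ge 0$. An AML quasistructure $\mathfrak M$ is a first-order $\mathcal L$-structure with universe $M$ together with, for each $n\ge 1$, an algebra $\mathcal B_n$ of subsets of $M^n$, a finitely additive measure $\mu=\mu_n:\mathcal B_n\to[0,\infty]$, and a function $v_n:\mathcal B_n\to\{\odot,\oplus,\ominus\}$ with $v_n(B)=\odot$ whenever $\mu_n(B)\notin\mathbb Q$, such that for $A\in\mathcal B_m$, $B\in\mathcal B_n$ one has $A\times B\in\mathcal B_{m+n}$ and $\mu_{m+n}(A\times B)=\mu_m(A)\mu_n(B)$. Satisfaction is defined as in first-order logic, with: $m_{\vec x}<q.\,\varphi(\vec x,\vec b)$ holds iff, for $D=\{\vec x:\mathfrak M\models\varphi(\vec x,\vec b)\}$, either $\mu(D)<q$, or $\mu(D)=q$ and $v(D)=\ominus$; and $m_{\vec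 x}\le q.\,\varphi(\vec x,\vec b)$ holds iff $\mu(D)<q$, or $\mu(D)=q$ and $v(D)\ne\oplus$. $\mathfrak M$ is an AML structure if every subset of every $M^n$ ($n\ge1$) definable by an AML formula with parameters lies in $\mathcal B_n$. "Formula", "definable" and "type" below refer to AML formulae. An elementary substructure of $\mathfrak M$ is an AML structure $\mathfrak N$ on a first-order substructure $N$ of $M$ such that $B\cap N^n\in\mathcal B_n^{\mathfrak N}$ for all $B\in\mathcal B_n^{\mathfrak M}$, and $\mathfrak N\models\varphi(\vec a)\iff\mathfrak M\models\varphi(\vec a)$ for all formulae $\varphi$ and all tuples $\vec a$ from $N$. $\mathfrak M$ is $\aleph_1$-saturated if, for every $n\ge1$ and every countable $A\subseteq M$, every set of formulae in $n$ variables with parameters from $A$ that is finitely satisfiable in $\mathfrak M$ is realized by some element of $M^n$. For a tuple $\vec a$ and $A\subseteq M$, $\operatorname{tp}(\vec a/A)$ is the set of formulae with parameters from $A$ satisfied by $\vec a$; it is wide if each of its members defines a set of positive measure. **Theorem.** Let $\mathfrak M$ be an $\aleph_1$-saturated AML $\mathcal L$-structure with $\mu(M)<\infty$, and let $\mathfrak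 N$ be a countable elementary substructure of $\mathfrak M$. Let $\vec a,\vec a'\in M^m$ and $\vec b,\vec b'\in M^n$ ($m,n\ge1$) satisfy $\operatorname{tp}(\vec a/N)=\operatorname{tp}(\vec a'/N)$ and $\operatorname{tp}(\vec b/N)=\operatorname{tp}(\vec b'/N)$, and suppose that $\operatorname{tp}(\vec a/N\cup\{\vec b\})$ and $\operatorname{tp}(\vec a'/N\cup\{\vec b'\})$ are both wide. Then for every $k\ge1$ and all sets $X\subseteq M^{k+m}$ and $Y\subseteq M^{k+n}$ definable with parameters from $N$, $$\mu(X_{\vec a}\cap Y_{\vec b})>0\iff\mu(X_{\vec a'}\cap Y_{\vec b'})>0,$$ where $X_{\vec a}=\{\vec z\in M^k:(\vec z,\vec a)\in X\}$ and $Y_{\vec b}=\{\vec z\in M^k:(\vec z,\vec b)\in Y\}$. -/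

import Mathlib

open scoped ENNReal NNReal

universe u v w

namespace AML

/-- Formulae of approximate measure logic over a signature `L`, with free variables among
`x_0, …, x_{n-1}` (so formulae are taken up to renaming of bound variables).  A quantifier binds
the last variable; the measure constructors `measLT q φ` (that is, `m_{z} < q. φ`) and
`measLE q φ` (that is, `m_{z} ≤ q. φ`) bind the last `k + 1` variables, so that a nonempty
tuple is always bound. -/
inductive Formula (L : FirstOrder.Language.{u, v}) : ℕ → Type (max u v)
  | equal {n : ℕ} (t₁ t₂ : L.Term (Fin n)) : Formula L n
  | rel {n l : ℕ} (R : L.Relations l) (ts : Fin l → L.Term (Fin n)) : Formula L n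
  | not {n : ℕ} (φ : Formula L n) : Formula L n
  | and {n : ℕ} (φ ψ : Formula L n) : Formula L n
  | ex {n : ℕ} (φ : Formula L (n + 1)) : Formula L n
  | all {n : ℕ} (φ : Formula L (n + 1)) : Formula L n
  | measLT {n k : ℕ} (q : ℚ≥0) (φ : Formula L (n + (k + 1))) : Formula L n
  | measLE {n k : ℕ} (q : ℚ≥0) (φ : Formula L (n + (k + 1))) : Formula L n

/-- The level of nesting of the measure constructors. -/
def Formula.rank {L : FirstOrder.Language.{u, v}} : {n : ℕ} → Formula L n → ℕ
  | _, .equal _ _ => 0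
  | _, .rel _ _ => 0
  | _, .not φ => φ.rank
  | _, .and φ ψ => max φ.rank ψ.rank
  | _, .ex φ => φ.rank
  | _, .all φ => φ.rank
  | _, .measLT _ φ => φ.rank + 1
  | _, .measLE _ φ => φ.rank + 1

/-- How the measure of a set is known: exactly (`⊙`), only as approximated from above (`⊕`), or
only as approximated from below (`⊖`). -/
inductive Mode
  | exact
  | above
  | below

/-- A nonnegative rational as an extended nonnegative real. -/
noncomputable def ratValue (q : ℚ≥0) : ℝ≥0∞ := ((q : ℝ≥0) : ℝ≥0∞)

/-- The set `A × B ⊆ M^(m+n)` for `A ⊆ M^m` and `B ⊆ M^n`. -/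
def rect {M : Type w} {m n : ℕ} (A : Set (Fin m → M)) (B : Set (Fin n → M)) :
    Set (Fin (m + n) → M) :=
  {x | (fun i => x (Fin.castAdd n i)) ∈ A ∧ (fun j => x (Fin.natAdd m j)) ∈ B}

/-- The data and axioms that turn a first-order `L`-structure `M` into an AML quasistructure: for
each `n ≥ 1` an algebra `𝓑 n` of subsets of `M^n`, a finitely additive measure `μ n` on it, and
an assignment `v n` of modes.  Only the values of `μ n` and `v n` at members of `𝓑 n`, with
`n ≥ 1`, are meaningful; the others are unconstrained and never matter for structures. -/
structure QuasiStructure (L : FirstOrder.Language.{u, v}) (M : Type w) [L.Structure M] where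
  𝓑 : (n : ℕ) → Set (Set (Fin n → M))
  μ : (n : ℕ) → Set (Fin n → M) → ℝ≥0∞
  v : (n : ℕ) → Set (Fin n → M) → Mode
  empty_mem : ∀ n, 0 < n → ∅ ∈ 𝓑 n
  compl_mem : ∀ n, 0 < n → ∀ A ∈ 𝓑 n, Aᶜ ∈ 𝓑 n
  union_mem : ∀ n, 0 < n → ∀ A ∈ 𝓑 n, ∀ B ∈ 𝓑 n, A ∪ B ∈ 𝓑 n
  μ_empty : ∀ n, 0 < n → μ n ∅ = 0
  μ_union : ∀ n, 0 < n → ∀ A ∈ 𝓑 n, ∀ B ∈ 𝓑 n, Disjoint A B → μ n (A ∪ B) = μ n A + μ n B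
  rect_mem : ∀ m n, 0 < m → 0 < n → ∀ A ∈ 𝓑 m, ∀ B ∈ 𝓑 n, rect A B ∈ 𝓑 (m + n)
  μ_rect : ∀ m n, 0 < m → 0 < n → ∀ A ∈ 𝓑 m, ∀ B ∈ 𝓑 n,
    μ (m + n) (rect A B) = μ m A * μ n B
  v_exact : ∀ n, 0 < n → ∀ A ∈ 𝓑 n, (¬ ∃ q : ℚ≥0, μ n A = ratValue q) → v n A = Mode.exact

namespace QuasiStructure

variable {L : FirstOrder.Language.{u, v}} {M : Type w} [L.Structure M]

/-- The satisfaction relation `𝔐 ⊨ φ[s]`. -/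
def Sat (𝔐 : QuasiStructure L M) : {n : ℕ} → Formula L n → (Fin n → M) → Prop
  | _, .equal t₁ t₂, s => t₁.realize s = t₂.realize s
  | _, .rel R ts, s => FirstOrder.Language.Structure.RelMap R (fun i => (ts i).realize s)
  | _, .not φ, s => ¬ 𝔐.Sat φ s
  | _, .and φ ψ, s => 𝔐.Sat φ s ∧ 𝔐.Sat ψ s
  | _, .ex φ, s => ∃ x : M, 𝔐.Sat φ (Fin.snoc s x)
  | _, .all φ, s => ∀ x : M, 𝔐.Sat φ (Fin.snoc s x)
  | _, .measLT (k := k) q φ, s =>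
      𝔐.μ (k + 1) {x | 𝔐.Sat φ (Fin.append s x)} < ratValue q ∨
        (𝔐.μ (k + 1) {x | 𝔐.Sat φ (Fin.append s x)} = ratValue q ∧
          𝔐.v (k + 1) {x | 𝔐.Sat φ (Fin.append s x)} = Mode.below)
  | _, .measLE (k := k) q φ, s =>
      𝔐.μ (k + 1) {x | 𝔐.Sat φ (Fin.append s x)} < ratValue q ∨
        (𝔐.μ (k + 1) {x | 𝔐.Sat φ (Fin.append s x)} = ratValue q ∧
          𝔐.v (k + 1) {x | 𝔐.Sat φ (Fin.append s x)} ≠ Mode.above)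

/-- The rank `r` measurability condition: every set defined, with parameters, by a formula of
rank at most `r` belongs to the algebra. -/
def RankMeasurable (𝔐 : QuasiStructure L M) (r : ℕ) : Prop :=
  ∀ (k n : ℕ), 0 < n → ∀ φ : Formula L (k + n), φ.rank ≤ r → ∀ b : Fin k → M,
    {x : Fin n → M | 𝔐.Sat φ (Fin.append b x)} ∈ 𝔐.𝓑 n

/-- An AML structure is a quasistructure with the measurability condition in all ranks. -/
def IsStructure (𝔐 : QuasiStructure L M) : Prop := ∀ r : ℕ, 𝔐.RankMeasurable r

/-- `𝔑`, living on a first-order substructure `N` of `M`, is an AML substructure of `𝔐`. -/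
def IsSubstructure {N : L.Substructure M} (𝔑 : QuasiStructure L N) (𝔐 : QuasiStructure L M) :
    Prop :=
  ∀ n : ℕ, 0 < n → ∀ B ∈ 𝔐.𝓑 n, {x : Fin n → N | (fun i => (x i : M)) ∈ B} ∈ 𝔑.𝓑 n

/-- `𝔑` is an elementary substructure of `𝔐`, with respect to all AML formulae. -/
def IsElementarySubstructure {N : L.Substructure M} (𝔑 : QuasiStructure L N)
    (𝔐 : QuasiStructure L M) : Prop :=
  𝔑.IsSubstructure 𝔐 ∧
    ∀ (n : ℕ) (φ : Formula L n) (a : Fin n → N), 𝔑.Sat φ a ↔ 𝔐.Sat φ (fun i => (a i : M))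

end QuasiStructure

/-- Formulae in the variables `x_0, …, x_{n-1}` with parameters from `A ⊆ M`: an AML formula in
`arity + n` variables, together with parameters from `A` for its first `arity` variables. -/
structure FormulaOver (L : FirstOrder.Language.{u, v}) {M : Type w} (A : Set M) (n : ℕ) where
  arity : ℕ
  formula : Formula L (arity + n)
  params : Fin arity → A

namespace QuasiStructure

variable {L : FirstOrder.Language.{u, v}} {M : Type w} [L.Structure M]

/-- The subset of `M^n` defined by a formula with parameters. -/
def defSet (𝔐 : QuasiStructure L M) {A : Set M} {n : ℕ} (φ : FormulaOver L A n) :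
    Set (Fin n → M) :=
  {x | 𝔐.Sat φ.formula (Fin.append (fun i => (φ.params i : M)) x)}

/-- `D ⊆ M^n` is definable with parameters from `A`. -/
def IsDefinable (𝔐 : QuasiStructure L M) (A : Set M) {n : ℕ} (D : Set (Fin n → M)) : Prop :=
  ∃ φ : FormulaOver L A n, D = 𝔐.defSet φ

/-- A set of formulae over `A` is a partial type if each finite subset is satisfied in `M`. -/
def IsPartialType (𝔐 : QuasiStructure L M) {A : Set M} {n : ℕ} (p : Set (FormulaOver L A n)) :
    Prop :=
  ∀ F : Set (FormulaOver L A n), F ⊆ p → F.Finite → ∃ a : Fin n → M, ∀ φ ∈ F, a ∈ 𝔐.defSet φ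

/-- `𝔐` is `ℵ₁`-saturated: each partial type over a countable set is realized. -/
def IsAlephOneSaturated (𝔐 : QuasiStructure L M) : Prop :=
  ∀ (n : ℕ), 0 < n → ∀ (A : Set M), A.Countable → ∀ p : Set (FormulaOver L A n),
    𝔐.IsPartialType p → ∃ a : Fin n → M, ∀ φ ∈ p, a ∈ 𝔐.defSet φ

/-- `tp(a/A)`, the set of formulae with parameters from `A` satisfied by `a`. -/
def tp (𝔐 : QuasiStructure L M) {n : ℕ} (a : Fin n → M) (A : Set M) : Set (FormulaOver L A n) :=
  {φ | a ∈ 𝔐.defSet φ}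

/-- A set of formulae is wide if each of its members defines a set of positive measure. -/
def IsWide (𝔐 : QuasiStructure L M) {A : Set M} {n : ℕ} (p : Set (FormulaOver L A n)) : Prop :=
  ∀ φ ∈ p, 0 < 𝔐.μ n (𝔐.defSet φ)

end QuasiStructure

/-- The fibre `X_a = {z ∈ M^k : (z, a) ∈ X}` of `X ⊆ M^(k+m)` over `a ∈ M^m`. -/
def fibre {M : Type w} {k m : ℕ} (X : Set (Fin (k + m) → M)) (a : Fin m → M) :
    Set (Fin k → M) :=
  {z | Fin.append z a ∈ X}

end AML

/-! In fact the two measures are equal. Let c run through N^n along an ultrafilter U converging to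
the common type of b and b' over N. For c in N the measure of X_a ∩ Y_c depends only on tp(a/N), so
it is unchanged when a is replaced by a'. It remains to prove that wideness of tp(a/Nb) forces μ(X_a
∩ Y_c) → μ(X_a ∩ Y_b) along U (`FinMeas.tendsto_val_inter`, applied in `tendsto_μ_fibre_inter`).

This is a Hilbert space stability argument. Sets Y_c picked successively along U have pairwise
intersections of nearly constant measure l. If two blocks of p such sets also meet across in measure
near l, their averaged indicators are close in L², so by Cauchy–Schwarz they have nearly the same
average intersection with any X_x. The first block c_i is chosen in N, with μ(X_a ∩ Y_{c_i}) near
the limit. The points x that behave towards the c_i as a does, and towards b as a does, form a set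
definable over Nb that contains a; by wideness it has positive measure. Replacing b by points d near
b leaves this measure bounded below, so among many such d_j some single x serves p of them. For this
x the average over the c_i is near the limit and the average over the chosen d_j is near μ(X_a ∩
Y_b), so these two numbers agree.

Measure need not be exactly definable, but a measure formula traps a definable set between {μ < q}
and {μ ≤ q}, which gives definable neighbourhoods on which measures vary little
(`IsDef.exists_nhds`). -/

open Filter Topology

/-! ### Finitely additive measures: atoms, Cauchy–Schwarz and double counting. -/

namespace AML

/-- A finite, finitely additive real-valued measure on an algebra of subsets of `Z`. -/
structure FinMeas (Z : Type*) where
  sets : Set (Set Z)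
  val : Set Z → ℝ
  empty_mem : ∅ ∈ sets
  compl_mem : ∀ A ∈ sets, Aᶜ ∈ sets
  union_mem : ∀ A ∈ sets, ∀ B ∈ sets, A ∪ B ∈ sets
  nonneg : ∀ A, 0 ≤ val A
  val_empty : val ∅ = 0
  val_union : ∀ A ∈ sets, ∀ B ∈ sets, Disjoint A B → val (A ∪ B) = val A + val B

namespace FinMeas

variable {Z : Type*} (ν : FinMeas Z)

theorem univ_mem : Set.univ ∈ ν.sets := by
  simpa using ν.compl_mem _ ν.empty_mem

theorem inter_mem {A B : Set Z} (hA : A ∈ ν.sets) (hB : B ∈ ν.sets) : A ∩ B ∈ ν.sets := by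
  have := ν.compl_mem _ (ν.union_mem _ (ν.compl_mem _ hA) _ (ν.compl_mem _ hB))
  rwa [Set.compl_union, compl_compl, compl_compl] at this

theorem biInter_mem {ι : Type*} (B : ι → Set Z) (hB : ∀ i, B i ∈ ν.sets) (s : Finset ι) :
    (⋂ i ∈ s, B i) ∈ ν.sets := by
  classical
  induction s using Finset.induction_on with
  | empty => simpa using ν.univ_mem
  | insert i s _ ih =>
    rw [Finset.set_biInter_insert]
    exact ν.inter_mem (hB i) ih

theorem val_mono {A B : Set Z} (hA : A ∈ ν.sets) (hB : B ∈ ν.sets) (h : A ⊆ B) :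
    ν.val A ≤ ν.val B := by
  have h1 : B = A ∪ (B ∩ Aᶜ) := by
    ext x; by_cases hx : x ∈ A
    · simp [hx, h hx]
    · simp [hx]
  have h2 := ν.val_union A hA (B ∩ Aᶜ) (ν.inter_mem hB (ν.compl_mem _ hA))
    (Set.disjoint_left.2 fun x hx hx' => hx'.2 hx)
  rw [← h1] at h2
  linarith [ν.nonneg (B ∩ Aᶜ)]

variable {ι : Type*} [Fintype ι]

open Classical in
/-- The set of indices of the members of a finite family of sets that contain `x`. -/
noncomputable def pattern (B : ι → Set Z) (x : Z) : Finset ι := Finset.univ.filter fun i => x ∈ B i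

theorem mem_pattern {B : ι → Set Z} {x : Z} {i : ι} : i ∈ pattern B x ↔ x ∈ B i := by
  simp [pattern]

theorem pattern_eq_mem {B : ι → Set Z} (hB : ∀ i, B i ∈ ν.sets) (S : Finset ι) :
    {x | pattern B x = S} ∈ ν.sets := by
  classical
  have h := ν.biInter_mem (fun i => if i ∈ S then B i else (B i)ᶜ)
    (fun i => by split_ifs; exacts [hB i, ν.compl_mem _ (hB i)]) Finset.univ
  convert h using 1
  ext x
  simp only [Set.mem_ofPred_eq, Finset.ext_iff, mem_pattern, Finset.mem_univ, Set.iInter_true,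
    Set.mem_iInter]
  refine forall_congr' fun i => ?_
  split_ifs with hi <;> simp [hi]

theorem val_pattern_mem {B : ι → Set Z} (hB : ∀ i, B i ∈ ν.sets) (T : Finset (Finset ι)) :
    {x | pattern B x ∈ T} ∈ ν.sets ∧
      ν.val {x | pattern B x ∈ T} = ∑ S ∈ T, ν.val {x | pattern B x = S} := by
  classical
  induction T using Finset.induction_on with
  | empty => simpa using ⟨ν.empty_mem, ν.val_empty⟩
  | insert S T hS ih =>
    have h : {x | pattern B x ∈ insert S T} = {x | pattern B x = S} ∪ {x | pattern B x ∈ T} := by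
      ext x; simp
    rw [h, Finset.sum_insert hS, ← ih.2]
    refine ⟨ν.union_mem _ (ν.pattern_eq_mem hB S) _ ih.1,
      ν.val_union _ (ν.pattern_eq_mem hB S) _ ih.1 (Set.disjoint_left.2 ?_)⟩
    rintro x rfl hx
    exact hS hx

/-- The patterns are the atoms of the algebra generated by the B i, so sums over patterns replace
integrals of simple functions. -/
theorem val_eq_sum_pattern {B : ι → Set Z} (hB : ∀ i, B i ∈ ν.sets) (P : Finset ι → Prop)
    [DecidablePred P] :
    ν.val {x | P (pattern B x)} = ∑ S, if P S then ν.val {x | pattern B x = S} else 0 := by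
  classical
  have h := (ν.val_pattern_mem hB (Finset.univ.filter P)).2
  rw [Finset.sum_filter] at h
  simpa using h

/-- The double sum is the integral of the square of ∑ t i · 1_{B i}, computed atom by atom. -/
theorem sum_mul_val_inter_nonneg {B : ι → Set Z} (hB : ∀ i, B i ∈ ν.sets) (t : ι → ℝ) :
    0 ≤ ∑ i, ∑ j, t i * t j * ν.val (B i ∩ B j) := by
  classical
  have h : ∀ i j, ν.val (B i ∩ B j) =
      ∑ S, if i ∈ S ∧ j ∈ S then ν.val {x | pattern B x = S} else 0 := by
    intro i j
    rw [← ν.val_eq_sum_pattern hB (fun S => i ∈ S ∧ j ∈ S)]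
    congr 1
    ext x
    simp [mem_pattern]
  have h2 : ∑ i, ∑ j, t i * t j * ν.val (B i ∩ B j) =
      ∑ S : Finset ι, ν.val {x | pattern B x = S} * (∑ i, if i ∈ S then t i else 0) ^ 2 := by
    simp_rw [h, Finset.mul_sum]
    rw [Finset.sum_congr rfl fun i _ => Finset.sum_comm, Finset.sum_comm]
    refine Finset.sum_congr rfl fun S _ => ?_
    rw [sq, Finset.sum_mul_sum, Finset.mul_sum]
    refine Finset.sum_congr rfl fun i _ => ?_
    rw [Finset.mul_sum]
    refine Finset.sum_congr rfl fun j _ => ?_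
    by_cases hi : i ∈ S <;> by_cases hj : j ∈ S <;> simp [hi, hj]; ring
  rw [h2]
  exact Finset.sum_nonneg fun S _ => mul_nonneg (ν.nonneg _) (sq_nonneg _)

/-- The Cauchy–Schwarz inequality for indicator functions. -/
theorem sq_sum_mul_val_inter_le {A : Set Z} (hA : A ∈ ν.sets) {B : ι → Set Z}
    (hB : ∀ i, B i ∈ ν.sets) (t : ι → ℝ) :
    (∑ i, t i * ν.val (A ∩ B i)) ^ 2 ≤
      ν.val A * ∑ i, ∑ j, t i * t j * ν.val (B i ∩ B j) := by
  -- Adjoin A with coefficient s to the family; the square integral is a nonnegative quadratic in s,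
  -- so its discriminant is at most 0.
  have key : ∀ s : ℝ, 0 ≤ ν.val A * (s * s) + (2 * ∑ i, t i * ν.val (A ∩ B i)) * s +
      ∑ i, ∑ j, t i * t j * ν.val (B i ∩ B j) := by
    intro s
    have h := ν.sum_mul_val_inter_nonneg (ι := Option ι) (B := fun o => o.elim A B)
      (by rintro (_ | i); exacts [hA, hB i]) (fun o => o.elim s t)
    simp only [Fintype.sum_option, Option.elim_none, Option.elim_some, Set.inter_self,
      Finset.sum_add_distrib] at h
    have e1 : ∑ i, s * t i * ν.val (A ∩ B i) = (∑ i, t i * ν.val (A ∩ B i)) * s := by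
      rw [Finset.sum_mul]; exact Finset.sum_congr rfl fun i _ => by ring
    have e2 : ∑ i, t i * s * ν.val (B i ∩ A) = (∑ i, t i * ν.val (A ∩ B i)) * s := by
      rw [Finset.sum_mul]
      exact Finset.sum_congr rfl fun i _ => by rw [Set.inter_comm]; ring
    rw [e1, e2] at h
    linarith
  have := discrim_le_zero key
  rw [discrim] at this
  linarith

/-- Some point lies in a proportion at least `ε / C` of a finite family of sets of measure at least
`ε`, if `C` is the total measure. -/
theorem exists_card_pattern_ge {B : ι → Set Z} (hB : ∀ i, B i ∈ ν.sets) {ε : ℝ} (hε : 0 < ε)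
    [Nonempty ι] (h : ∀ i, ε ≤ ν.val (B i)) :
    ∃ x, ε * Fintype.card ι ≤ ν.val Set.univ * (pattern B x).card := by
  classical
  by_contra! hcon
  have h1 : ∑ i, ν.val (B i) = ∑ S : Finset ι, ν.val {x | pattern B x = S} * S.card := by
    have : ∀ i, ν.val (B i) = ∑ S, if i ∈ S then ν.val {x | pattern B x = S} else 0 := by
      intro i
      rw [← ν.val_eq_sum_pattern hB (fun S => i ∈ S)]
      simp [mem_pattern]
    simp_rw [this]
    rw [Finset.sum_comm]
    refine Finset.sum_congr rfl fun S _ => ?_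
    rw [Finset.sum_ite_mem, Finset.univ_inter, Finset.sum_const, nsmul_eq_mul, mul_comm]
  have h2 : ν.val Set.univ = ∑ S : Finset ι, ν.val {x | pattern B x = S} := by
    simpa using ν.val_eq_sum_pattern hB (fun _ => True)
  have h3 : ε * Fintype.card ι ≤ ∑ i, ν.val (B i) := by
    have := Finset.card_nsmul_le_sum Finset.univ (fun i => ν.val (B i)) ε fun i _ => h i
    rwa [nsmul_eq_mul, mul_comm] at this
  have h0 : 0 < ε * Fintype.card ι := by have := Fintype.card_pos (α := ι); positivity
  have hpos : 0 < ν.val Set.univ := by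
    obtain ⟨i⟩ := ‹Nonempty ι›
    exact hε.trans_le ((h i).trans (ν.val_mono (hB i) ν.univ_mem (Set.subset_univ _)))
  -- Sum the assumed inequality over the atoms; it is strict at an atom of positive measure, which
  -- exists as the total is positive.
  have h4 : ν.val Set.univ * ∑ i, ν.val (B i) < ν.val Set.univ * (ε * Fintype.card ι) := by
    rw [h1, Finset.mul_sum]
    conv_rhs => rw [h2, Finset.sum_mul]
    have hle : ∀ S : Finset ι, ν.val Set.univ * (ν.val {x | pattern B x = S} * S.card) ≤
        ν.val {x | pattern B x = S} * (ε * Fintype.card ι) := by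
      intro S
      rcases Set.eq_empty_or_nonempty {x | pattern B x = S} with he | ⟨x, hx⟩
      · rw [he, ν.val_empty]; simp
      · have := (hcon x).le
        rw [show pattern B x = S from hx] at this
        nlinarith [ν.nonneg {x | pattern B x = S}]
    refine Finset.sum_lt_sum (fun S _ => hle S) ?_
    obtain ⟨S, -, hS⟩ := Finset.exists_ne_zero_of_sum_ne_zero (h2 ▸ hpos.ne')
    have hSpos := (ν.nonneg {x | pattern B x = S}).lt_of_ne' hS
    obtain ⟨x, hx⟩ : {x | pattern B x = S}.Nonempty := by
      by_contra hne
      rw [Set.not_nonempty_iff_eq_empty] at hne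
      rw [hne, ν.val_empty] at hS
      exact hS rfl
    refine ⟨S, Finset.mem_univ _, ?_⟩
    have := hcon x
    rw [show pattern B x = S from hx] at this
    nlinarith
  exact absurd (lt_of_mul_lt_mul_left h4 hpos.le) (not_lt.2 h3)

/-- If the pairwise intersections of two families of `p` sets all have nearly the same measure,
then the two families have nearly the same average intersection with any set. -/
theorem abs_sum_sub_sum_le {A : Set Z} (hA : A ∈ ν.sets) {p : ℕ} {B D : Fin p → Set Z}
    (hB : ∀ i, B i ∈ ν.sets) (hD : ∀ i, D i ∈ ν.sets) {l δ C : ℝ} (hδ : 0 < δ) (hl : 0 ≤ l)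
    (hC : ν.val Set.univ ≤ C)
    (hBB : ∀ i j, i ≠ j → |ν.val (B i ∩ B j) - l| ≤ δ)
    (hDD : ∀ i j, i ≠ j → |ν.val (D i ∩ D j) - l| ≤ δ)
    (hBD : ∀ i j, |ν.val (B i ∩ D j) - l| ≤ δ) :
    (∑ i, ν.val (A ∩ B i) - ∑ i, ν.val (A ∩ D i)) ^ 2 ≤ C * (2 * p * C + 4 * p ^ 2 * δ) := by
  have hval : ∀ E ∈ ν.sets, ν.val E ≤ C := fun E hE =>
    (ν.val_mono hE ν.univ_mem (Set.subset_univ _)).trans hC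
  have hC0 : 0 ≤ C := (ν.nonneg _).trans hC
  -- Coefficients 1 on B and -1 on D make the main terms p² l cancel.
  have h := ν.sq_sum_mul_val_inter_le (ι := Fin p ⊕ Fin p) hA (B := Sum.elim B D)
    (by rintro (i | i); exacts [hB i, hD i]) (Sum.elim (fun _ => 1) (fun _ => -1))
  simp only [Fintype.sum_sum_type, Sum.elim_inl, Sum.elim_inr, one_mul, mul_one, neg_mul,
    mul_neg, Finset.sum_neg_distrib, Finset.sum_sub_distrib, ← sub_eq_add_neg] at h
  have self : ∀ E : Fin p → Set Z, (∀ i, E i ∈ ν.sets) →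
      (∀ i j, i ≠ j → |ν.val (E i ∩ E j) - l| ≤ δ) →
      ∑ i, ∑ j, ν.val (E i ∩ E j) ≤ p * C + p ^ 2 * (l + δ) := by
    intro E hE hEE
    -- The diagonal is bounded only by C, but it has just p terms out of p².
    have : ∀ i j, ν.val (E i ∩ E j) ≤ (if i = j then C else 0) + (l + δ) := by
      intro i j
      split_ifs with hij
      · linarith [hval _ (ν.inter_mem (hE i) (hE j))]
      · linarith [(abs_le.1 (hEE i j hij)).2]
    refine (Finset.sum_le_sum fun i _ => Finset.sum_le_sum fun j _ => this i j).trans ?_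
    simp [Finset.sum_add_distrib]
    apply le_of_eq; ring
  have cross : ∀ E F : Fin p → Set Z, (∀ i j, |ν.val (E i ∩ F j) - l| ≤ δ) →
      p ^ 2 * (l - δ) ≤ ∑ i, ∑ j, ν.val (E i ∩ F j) := by
    intro E F hEF
    refine le_trans ?_ (Finset.sum_le_sum fun i _ => Finset.sum_le_sum fun j _ =>
      show l - δ ≤ ν.val (E i ∩ F j) by linarith [(abs_le.1 (hEF i j)).1])
    simp
    apply le_of_eq; ring
  have hDB : ∀ i j, |ν.val (D i ∩ B j) - l| ≤ δ := fun i j => by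
    rw [Set.inter_comm]; exact hBD j i
  refine h.trans (mul_le_mul (hval A hA) ?_ ?_ hC0)
  · linarith [self B hB hBB, self D hD hDD, cross B D hBD, cross D B hDB]
  · have := ν.sum_mul_val_inter_nonneg (ι := Fin p ⊕ Fin p) (B := Sum.elim B D)
      (by rintro (i | i); exacts [hB i, hD i]) (Sum.elim (fun _ => 1) (fun _ => -1))
    simpa only [Fintype.sum_sum_type, Sum.elim_inl, Sum.elim_inr, one_mul, mul_one, neg_mul,
      mul_neg, Finset.sum_neg_distrib, Finset.sum_sub_distrib, ← sub_eq_add_neg] using this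

end FinMeas

/-! ### Iterated limits along an ultrafilter and the stability argument. -/

theorem exists_tendsto_of_mem_Icc {Q : Type*} (U : Ultrafilter Q) {f : Q → ℝ} {C : ℝ}
    (hf : ∀ c, f c ∈ Set.Icc 0 C) : ∃ l ∈ Set.Icc 0 C, Tendsto f U (𝓝 l) :=
  isCompact_Icc.ultrafilter_le_nhds' (U.map f) (Filter.mem_map.2 (Filter.univ_mem' hf))

/-- A sequence along which a function of two variables is nearly equal to its iterated limit. -/
theorem exists_seq_near_iterated_limit {Q : Type*} (U : Ultrafilter Q) {g : Q → Q → ℝ} {h : Q → ℝ}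
    {l δ : ℝ} (hg : ∀ c, Tendsto (g c) U (𝓝 (h c))) (hh : Tendsto h U (𝓝 l)) (hδ : 0 < δ)
    (F : Finset Q) (hF : ∀ d ∈ F, |h d - l| < δ / 2) {T : Set Q} (hT : T ∈ U) :
    ∃ c : ℕ → Q, (∀ i, c i ∈ T ∧ |h (c i) - l| < δ / 2 ∧ ∀ d ∈ F, |g d (c i) - l| < δ) ∧
      ∀ i j, i < j → |g (c i) (c j) - l| < δ := by
  have hδ2 : 0 < δ / 2 := half_pos hδ
  have near : ∀ s : Finset Q, (∀ d ∈ s, |h d - l| < δ / 2) →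
      ∀ᶠ c in (U : Filter Q), ∀ d ∈ s, |g d c - l| < δ := by
    intro s hs
    refine (Filter.eventually_all_finset s).2 fun d hd => ?_
    filter_upwards [Metric.tendsto_nhds.1 (hg d) _ hδ2] with c hc
    rw [Real.dist_eq] at hc
    have := abs_add_le (g d c - h d) (h d - l)
    rw [sub_add_sub_cancel] at this
    linarith [hs d hd]
  have hhl : ∀ᶠ c in (U : Filter Q), |h c - l| < δ / 2 := by
    simpa only [Real.dist_eq] using Metric.tendsto_nhds.1 hh _ hδ2
  refine exists_seq_of_forall_finset_exists
    (fun c => c ∈ T ∧ |h c - l| < δ / 2 ∧ ∀ d ∈ F, |g d c - l| < δ)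
    (fun c d => |g c d - l| < δ) fun s hs => ?_
  have hTe : ∀ᶠ c in (U : Filter Q), c ∈ T := hT
  obtain ⟨c, h1, h2, h3, h4⟩ :=
    (hTe.and (hhl.and ((near F hF).and (near s fun d hd => (hs d hd).2.1)))).exists
  exact ⟨c, ⟨h1, h2, h3⟩, h4⟩

theorem abs_sum_sub_le {p : ℕ} {f : Fin p → ℝ} {l τ : ℝ} (h : ∀ i, |f i - l| ≤ τ) :
    |∑ i, f i - p * l| ≤ p * τ := by
  have h1 : ∑ i, f i - p * l = ∑ i, (f i - l) := by simp
  rw [h1]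
  refine (Finset.abs_sum_le_sum_abs _ _).trans ((Finset.sum_le_sum fun i _ => h i).trans ?_)
  simp

/-- The stability argument: if near `(a, b)` the measures of `Xs x ∩ Ys d` are nearly constant on
sets `S d` whose measure is bounded below for most `d`, then the measure of `Xs a ∩ Ys b` is the
limit of the measures of `Xs a ∩ Ys c`. -/
theorem FinMeas.tendsto_val_inter {Z P Q : Type*} (ν : FinMeas Z) (ν' : FinMeas P)
    {Xs : P → Set Z} {Ys : Q → Set Z} (hXs : ∀ x, Xs x ∈ ν.sets) (hYs : ∀ y, Ys y ∈ ν.sets)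
    (U : Ultrafilter Q) {Q₀ : Set Q} (hQ₀ : Q₀ ∈ U) (a : P) (b : Q)
    (H : ∀ (p : ℕ) (c : Fin p → Q), (∀ i, c i ∈ Q₀) → ∀ τ > 0, ∃ S : Q → Set P,
      (∀ d, S d ∈ ν'.sets) ∧ (∃ ε > 0, ∀ᶠ d in (U : Filter Q), ε ≤ ν'.val (S d)) ∧
      ∀ d, ∀ x ∈ S d, |ν.val (Xs x ∩ Ys d) - ν.val (Xs a ∩ Ys b)| ≤ τ ∧
        ∀ i, |ν.val (Xs x ∩ Ys (c i)) - ν.val (Xs a ∩ Ys (c i))| ≤ τ) :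
    Tendsto (fun c => ν.val (Xs a ∩ Ys c)) U (𝓝 (ν.val (Xs a ∩ Ys b))) := by
  classical
  obtain ⟨C, hC, hC1⟩ : ∃ C, ν.val Set.univ ≤ C ∧ 1 ≤ C := ⟨_, le_max_left _ _, le_max_right _ 1⟩
  have hIcc : ∀ A ∈ ν.sets, ν.val A ∈ Set.Icc 0 C := fun A hA =>
    ⟨ν.nonneg A, (ν.val_mono hA ν.univ_mem (Set.subset_univ _)).trans hC⟩
  obtain ⟨F, -, hF⟩ := exists_tendsto_of_mem_Icc U
    fun c => hIcc _ (ν.inter_mem (hXs a) (hYs c))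
  choose h hhI hh using fun d => exists_tendsto_of_mem_Icc U
    fun c => hIcc _ (ν.inter_mem (hYs d) (hYs c))
  obtain ⟨l, hl, hhl⟩ := exists_tendsto_of_mem_Icc U hhI
  suffices hmain : ∀ τ : ℝ, 0 < τ → |ν.val (Xs a ∩ Ys b) - F| ≤ 4 * τ by
    have : ν.val (Xs a ∩ Ys b) = F := by
      rw [← sub_eq_zero, ← abs_nonpos_iff]
      refine le_of_forall_pos_le_add fun τ hτ => ?_
      have := hmain (τ / 4) (by positivity)
      linarith
    rwa [this]
  intro τ hτ
  -- δ and p make each half of the Cauchy–Schwarz error C(2pC + 4p²δ) at most p²τ²/2.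
  obtain ⟨δ, hδ, hδτ⟩ : ∃ δ : ℝ, 0 < δ ∧ 4 * C * δ ≤ τ ^ 2 / 2 :=
    ⟨τ ^ 2 / (8 * C), by positivity, by field_simp; norm_num⟩
  obtain ⟨p, hp⟩ := exists_nat_gt (4 * C ^ 2 / τ ^ 2)
  have hp0 : (0 : ℝ) < p := lt_of_le_of_lt (by positivity) hp
  rw [div_lt_iff₀ (by positivity)] at hp
  have hFτ : ∀ᶠ c in (U : Filter Q), |ν.val (Xs a ∩ Ys c) - F| < τ := by
    simpa only [Real.dist_eq] using Metric.tendsto_nhds.1 hF _ hτ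
  obtain ⟨c, hc, hcc⟩ := exists_seq_near_iterated_limit U hh hhl hδ ∅ (by simp)
    (T := Q₀ ∩ {c | |ν.val (Xs a ∩ Ys c) - F| < τ}) (Filter.inter_mem hQ₀ hFτ)
  obtain ⟨S, hS, ⟨ε, hε, hSε⟩, hSx⟩ := H p (fun i => c i) (fun i => (hc i).1.1) τ hτ
  -- The d's come after S, which depends on the c's; feeding in the c's makes the cross
  -- intersections near l too.
  obtain ⟨d, hd, hdd⟩ := exists_seq_near_iterated_limit U hh hhl hδ
    ((Finset.range p).image c) (by simpa using fun i _ => (hc i).2.1) hSε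
  -- With this K, an ε / ν'(univ) proportion of K sets is at least p of them.
  obtain ⟨K, hK⟩ := exists_nat_gt (ν'.val Set.univ * p / ε)
  have hK0 : (0 : ℝ) < K := lt_of_le_of_lt
    (div_nonneg (mul_nonneg (ν'.nonneg _) hp0.le) hε.le) hK
  rw [div_lt_iff₀ hε] at hK
  have : Nonempty (Fin K) := ⟨⟨0, by exact_mod_cast hK0⟩⟩
  obtain ⟨x, hx⟩ := ν'.exists_card_pattern_ge (B := fun i : Fin K => S (d i)) (fun i => hS _) hε
    fun i => (hd i).1
  have hcard : p ≤ (FinMeas.pattern (fun i : Fin K => S (d i)) x).card := by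
    by_contra! hlt
    have hlt' : ((FinMeas.pattern (fun i : Fin K => S (d i)) x).card : ℝ) ≤ p := by
      exact_mod_cast hlt.le
    have := mul_le_mul_of_nonneg_left hlt' (ν'.nonneg Set.univ)
    rw [Fintype.card_fin] at hx
    linarith
  obtain ⟨J, hJ, hJp⟩ := Finset.exists_subset_card_eq hcard
  set e := J.orderEmbOfFin hJp
  have heS : ∀ i, x ∈ S (d (e i)) := fun i =>
    FinMeas.mem_pattern (B := fun i : Fin K => S (d i)).1 (hJ (J.orderEmbOfFin_mem hJp i))
  have sym : ∀ (s : ℕ → Q), (∀ i j, i < j → |ν.val (Ys (s i) ∩ Ys (s j)) - l| < δ) →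
      ∀ i j, i ≠ j → |ν.val (Ys (s i) ∩ Ys (s j)) - l| ≤ δ := by
    intro s hs i j hij
    rcases lt_or_gt_of_ne hij with h' | h'
    · exact (hs i j h').le
    · rw [Set.inter_comm]; exact (hs j i h').le
  have hCS := ν.abs_sum_sub_sum_le (hXs x) (p := p) (B := fun i => Ys (c i))
    (D := fun i => Ys (d (e i))) (fun _ => hYs _) (fun _ => hYs _) hδ hl.1 hC
    (fun i j hij => sym c hcc i j (fun h' => hij (Fin.ext h')))
    (fun i j hij => sym d hdd _ _ (fun h' => hij (e.injective (Fin.ext h'))))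
    (fun i j => ((hd _).2.2 _ (Finset.mem_image_of_mem c (Finset.mem_range.2 i.2))).le)
  have hdiff : |∑ i : Fin p, ν.val (Xs x ∩ Ys (c i)) - ∑ i : Fin p, ν.val (Xs x ∩ Ys (d (e i)))|
      ≤ p * τ := by
    refine abs_le_of_sq_le_sq (hCS.trans ?_) (by positivity)
    nlinarith [mul_le_mul_of_nonneg_left hδτ (sq_nonneg (p : ℝ)),
      mul_le_mul_of_nonneg_left hp.le hp0.le]
  have h1 : |∑ i : Fin p, ν.val (Xs x ∩ Ys (c i)) - p * F| ≤ p * (2 * τ) := by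
    refine abs_sum_sub_le fun i => ?_
    have e1 := (hSx (d (e ⟨0, by exact_mod_cast hp0⟩)) x (heS _)).2 i
    have e2 := (hc i).1.2
    have := abs_sub_le (ν.val (Xs x ∩ Ys (c i))) (ν.val (Xs a ∩ Ys (c i))) F
    have e3 : |ν.val (Xs a ∩ Ys (c i)) - F| < τ := e2
    linarith
  have h2 : |∑ i : Fin p, ν.val (Xs x ∩ Ys (d (e i))) - p * ν.val (Xs a ∩ Ys b)| ≤ p * τ :=
    abs_sum_sub_le fun i => (hSx _ x (heS i)).1
  -- The errors are τ for the d's, τ for Cauchy–Schwarz and 2τ for the c's.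
  refine le_of_mul_le_mul_left ?_ hp0
  rw [← abs_of_pos hp0, ← abs_mul, abs_of_pos hp0, mul_sub]
  rw [abs_le] at *
  constructor <;> linarith [hdiff.1, hdiff.2, h1.1, h1.2, h2.1, h2.2]

end AML

/-! ### Syntax: renaming variables and blocks of quantifiers. -/

namespace AML

section Rename

variable {L : FirstOrder.Language.{u, v}} {M : Type w}

/-- Extend a map of variables by the identity on `k` bound variables. -/
def liftMap {n n' : ℕ} (ρ : Fin n → Fin n') (k : ℕ) : Fin (n + k) → Fin (n' + k) :=
  Fin.append (fun i => Fin.castAdd k (ρ i)) (Fin.natAdd n')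

theorem append_comp_liftMap {n n' k : ℕ} (ρ : Fin n → Fin n') (s : Fin n' → M) (x : Fin k → M) :
    Fin.append s x ∘ liftMap ρ k = Fin.append (s ∘ ρ) x := by
  funext i
  refine Fin.addCases (fun i => ?_) (fun i => ?_) i <;> simp [liftMap]

theorem snoc_comp_liftMap {n n' : ℕ} (ρ : Fin n → Fin n') (s : Fin n' → M) (x : M) :
    (Fin.snoc s x : Fin (n' + 1) → M) ∘ liftMap ρ 1 = Fin.snoc (s ∘ ρ) x := by
  have h := append_comp_liftMap ρ s (fun _ : Fin 1 => x)
  simpa only [Fin.append_right_eq_snoc] using h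

/-- Rename the free variables of a formula. -/
def Formula.rename : {n n' : ℕ} → Formula L n → (Fin n → Fin n') → Formula L n'
  | _, _, .equal t₁ t₂, ρ => .equal (t₁.relabel ρ) (t₂.relabel ρ)
  | _, _, .rel R ts, ρ => .rel R fun i => (ts i).relabel ρ
  | _, _, .not φ, ρ => .not (φ.rename ρ)
  | _, _, .and φ ψ, ρ => .and (φ.rename ρ) (ψ.rename ρ)
  | _, _, .ex φ, ρ => .ex (φ.rename (liftMap ρ 1))
  | _, _, .all φ, ρ => .all (φ.rename (liftMap ρ 1))
  | _, _, .measLT (k := k) q φ, ρ => .measLT (k := k) q (φ.rename (liftMap ρ (k + 1)))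
  | _, _, .measLE (k := k) q φ, ρ => .measLE (k := k) q (φ.rename (liftMap ρ (k + 1)))

/-- Quantify existentially over the last `n` variables. -/
def Formula.exs {p : ℕ} : (n : ℕ) → Formula L (p + n) → Formula L p
  | 0, φ => φ
  | n + 1, φ => Formula.exs n (.ex φ)

end Rename

namespace QuasiStructure

variable {L : FirstOrder.Language.{u, v}} {M : Type w} [L.Structure M] (𝔐 : QuasiStructure L M)

theorem sat_rename {n : ℕ} (φ : Formula L n) : ∀ {n' : ℕ} (ρ : Fin n → Fin n') (s : Fin n' → M),
    𝔐.Sat (φ.rename ρ) s ↔ 𝔐.Sat φ (s ∘ ρ) := by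
  induction φ with
  | equal t₁ t₂ => intro n' ρ s; simp [Formula.rename, Sat]
  | rel R ts => intro n' ρ s; simp [Formula.rename, Sat]
  | not φ ih => intro n' ρ s; simp [Formula.rename, Sat, ih]
  | and φ ψ ih ih' => intro n' ρ s; simp [Formula.rename, Sat, ih, ih']
  | ex φ ih => intro n' ρ s; simp only [Formula.rename, Sat, ih, snoc_comp_liftMap]
  | all φ ih => intro n' ρ s; simp only [Formula.rename, Sat, ih, snoc_comp_liftMap]
  | measLT q φ ih => intro n' ρ s; simp only [Formula.rename, Sat, ih, append_comp_liftMap]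
  | measLE q φ ih => intro n' ρ s; simp only [Formula.rename, Sat, ih, append_comp_liftMap]

theorem sat_exs {p : ℕ} : ∀ (n : ℕ) (φ : Formula L (p + n)) (s : Fin p → M),
    𝔐.Sat (φ.exs n) s ↔ ∃ x : Fin n → M, 𝔐.Sat φ (Fin.append s x)
  | 0, φ, s => by
    constructor
    · intro h
      exact ⟨Fin.elim0, by rw [Fin.append_elim0]; exact h⟩
    · rintro ⟨x, h⟩
      rw [Fin.append_right_nil s x rfl] at h
      exact h
  | n + 1, φ, s => by
    rw [Formula.exs, sat_exs n]
    simp only [Sat]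
    constructor
    · rintro ⟨x, y, h⟩
      exact ⟨Fin.snoc x y, by rwa [Fin.append_snoc]⟩
    · rintro ⟨x, h⟩
      refine ⟨Fin.init x, x (Fin.last n), ?_⟩
      rwa [← Fin.append_snoc, Fin.snoc_init_self]

/-! ### Definable sets over arbitrary index types, and near definability of measure. -/

/-- The set `D ⊆ M^ι` is definable without parameters. -/
def IsDef₀ {ι : Type*} (D : Set (ι → M)) : Prop :=
  ∃ (p : ℕ) (φ : Formula L p) (ρ : Fin p → ι), ∀ x, x ∈ D ↔ 𝔐.Sat φ (x ∘ ρ)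

/-- The set `D ⊆ M^ι` is definable with parameters from `A`. -/
def IsDef (A : Set M) {ι : Type*} (D : Set (ι → M)) : Prop :=
  ∃ (q : ℕ) (c : Fin q → A) (D₀ : Set (Fin q ⊕ ι → M)), 𝔐.IsDef₀ D₀ ∧
    ∀ x, x ∈ D ↔ Sum.elim (fun i => (c i : M)) x ∈ D₀

variable {𝔐}

section

variable {ι κ : Type*}

theorem IsDef₀.compl {D : Set (ι → M)} (h : 𝔐.IsDef₀ D) : 𝔐.IsDef₀ Dᶜ := by
  obtain ⟨p, φ, ρ, h⟩ := h
  exact ⟨p, .not φ, ρ, fun x => by simp [Sat, h]⟩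

theorem IsDef₀.reindex {D : Set (ι → M)} (h : 𝔐.IsDef₀ D) (σ : ι → κ) :
    𝔐.IsDef₀ {x : κ → M | x ∘ σ ∈ D} := by
  obtain ⟨p, φ, ρ, h⟩ := h
  exact ⟨p, φ, σ ∘ ρ, fun x => h (x ∘ σ)⟩

theorem IsDef₀.inter {D E : Set (ι → M)} (h : 𝔐.IsDef₀ D) (h' : 𝔐.IsDef₀ E) :
    𝔐.IsDef₀ (D ∩ E) := by
  obtain ⟨p, φ, ρ, h⟩ := h
  obtain ⟨p', φ', ρ', h'⟩ := h'
  refine ⟨p + p', .and (φ.rename (Fin.castAdd p')) (φ'.rename (Fin.natAdd p)),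
    Fin.append ρ ρ', fun x => ?_⟩
  simp only [Sat, sat_rename, Set.mem_inter_iff, h, h']
  have e1 : (x ∘ Fin.append ρ ρ') ∘ Fin.castAdd p' = x ∘ ρ := by funext i; simp
  have e2 : (x ∘ Fin.append ρ ρ') ∘ Fin.natAdd p = x ∘ ρ' := by funext i; simp
  rw [e1, e2]

theorem IsDef₀.exists_formula {j : ℕ} {D : Set (ι → M)} (h : 𝔐.IsDef₀ D) (e : ι → Fin j) :
    ∃ φ : Formula L j, ∀ x : Fin j → M, x ∘ e ∈ D ↔ 𝔐.Sat φ x := by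
  obtain ⟨p, φ, ρ, h⟩ := h
  exact ⟨φ.rename (e ∘ ρ), fun x => by rw [sat_rename, h]; rfl⟩

theorem append_comp_finSumFinEquiv {p n : ℕ} (x : Fin p → M) (y : Fin n → M) :
    Fin.append x y ∘ finSumFinEquiv = Sum.elim x y := by
  funext i; rcases i with i | i <;> simp

/-- The measure of the fibre of a definable set is nearly definable. -/
theorem IsDef₀.exists_meas [Finite ι] {k : ℕ} (hk : 0 < k) {D : Set (ι ⊕ Fin k → M)}
    (h : 𝔐.IsDef₀ D) (q : ℚ≥0) :
    ∃ E : Set (ι → M), 𝔐.IsDef₀ E ∧ (∀ y, 𝔐.μ k {z | Sum.elim y z ∈ D} < ratValue q → y ∈ E) ∧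
      ∀ y ∈ E, 𝔐.μ k {z | Sum.elim y z ∈ D} ≤ ratValue q := by
  obtain ⟨k, rfl⟩ := Nat.exists_eq_succ_of_ne_zero hk.ne'
  obtain ⟨j, ⟨e⟩⟩ := Finite.exists_equiv_fin ι
  obtain ⟨φ, hφ⟩ := h.exists_formula (finSumFinEquiv ∘ Sum.map e id : _ → Fin (j + (k + 1)))
  have key : ∀ y : ι → M, {z | 𝔐.Sat φ (Fin.append (y ∘ e.symm) z)} =
      {z | Sum.elim y z ∈ D} := by
    intro y
    ext z
    rw [Set.mem_ofPred_eq, ← hφ, ← Function.comp_assoc, append_comp_finSumFinEquiv,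
      Sum.elim_comp_map]
    simp [Function.comp_assoc]
  -- The mode matters only when the measure equals q, where either answer is allowed.
  refine ⟨{y | 𝔐.Sat (.measLT (k := k) q φ) (y ∘ e.symm)}, ⟨j, _, e.symm, fun y => Iff.rfl⟩,
    fun y hy => ?_, fun y hy => ?_⟩
  · rw [Set.mem_ofPred_eq, Sat, key]
    exact Or.inl hy
  · rw [Set.mem_ofPred_eq, Sat, key] at hy
    rcases hy with hy | hy
    exacts [hy.le, hy.1.le]

variable {A : Set M}

theorem IsDef.compl {D : Set (ι → M)} (h : 𝔐.IsDef A D) : 𝔐.IsDef A Dᶜ := by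
  obtain ⟨q, c, D₀, h₀, h⟩ := h
  exact ⟨q, c, D₀ᶜ, h₀.compl, fun x => not_congr (h x)⟩

theorem IsDef.reindex {D : Set (ι → M)} (h : 𝔐.IsDef A D) (σ : ι → κ) :
    𝔐.IsDef A {x : κ → M | x ∘ σ ∈ D} := by
  obtain ⟨q, c, D₀, h₀, h⟩ := h
  refine ⟨q, c, _, h₀.reindex (Sum.map id σ), fun x => ?_⟩
  rw [Set.mem_ofPred_eq, h, Set.mem_ofPred_eq, Sum.elim_comp_map]
  rfl

theorem IsDef.inter {D E : Set (ι → M)} (h : 𝔐.IsDef A D) (h' : 𝔐.IsDef A E) :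
    𝔐.IsDef A (D ∩ E) := by
  obtain ⟨q, c, D₀, h₀, h⟩ := h
  obtain ⟨q', c', D₀', h₀', h'⟩ := h'
  refine ⟨q + q', Fin.append c c', _, (h₀.reindex (Sum.map (Fin.castAdd q') id)).inter
    (h₀'.reindex (Sum.map (Fin.natAdd q) id)), fun x => ?_⟩
  rw [Set.mem_inter_iff, h, h', Set.mem_inter_iff, Set.mem_ofPred_eq, Set.mem_ofPred_eq,
    Sum.elim_comp_map, Sum.elim_comp_map]
  have e1 : (fun i => ((Fin.append c c' i : A) : M)) ∘ Fin.castAdd q' = fun i => (c i : M) := by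
    funext i; simp
  have e2 : (fun i => ((Fin.append c c' i : A) : M)) ∘ Fin.natAdd q = fun i => (c' i : M) := by
    funext i; simp
  rw [e1, e2]
  rfl

theorem IsDef.univ : 𝔐.IsDef A (Set.univ : Set (ι → M)) :=
  ⟨0, Fin.elim0, Set.univ, ⟨0, .all (.equal (.var 0) (.var 0)), Fin.elim0,
    fun x => by simp [Sat]⟩, fun _ => by simp⟩

theorem IsDef.subst {j : ℕ} {D : Set (Fin j ⊕ ι → M)} (h : 𝔐.IsDef A D) (a : Fin j → A) :
    𝔐.IsDef A {x : ι → M | Sum.elim (fun i => (a i : M)) x ∈ D} := by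
  obtain ⟨q, c, D₀, h₀, h⟩ := h
  refine ⟨q + j, Fin.append c a, _, h₀.reindex (Sum.elim (fun i => Sum.inl (Fin.castAdd j i))
    (Sum.map (Fin.natAdd q) id)), fun x => ?_⟩
  rw [Set.mem_ofPred_eq, h, Set.mem_ofPred_eq]
  convert Iff.rfl using 2
  funext i
  rcases i with i | i | i <;> simp

theorem IsDef.mono {B : Set M} (hAB : A ⊆ B) {D : Set (ι → M)} (h : 𝔐.IsDef A D) :
    𝔐.IsDef B D := by
  obtain ⟨q, c, h⟩ := h
  exact ⟨q, fun i => ⟨c i, hAB (c i).2⟩, h⟩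

theorem IsDef.exists_meas [Finite ι] {k : ℕ} (hk : 0 < k) {D : Set (ι ⊕ Fin k → M)}
    (h : 𝔐.IsDef A D) (q : ℚ≥0) :
    ∃ E : Set (ι → M), 𝔐.IsDef A E ∧ (∀ y, 𝔐.μ k {z | Sum.elim y z ∈ D} < ratValue q → y ∈ E) ∧
      ∀ y ∈ E, 𝔐.μ k {z | Sum.elim y z ∈ D} ≤ ratValue q := by
  obtain ⟨r, c, D₀, h₀, h⟩ := h
  obtain ⟨E, hE, h1, h2⟩ := (h₀.reindex (Equiv.sumAssoc _ _ _).symm).exists_meas hk q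
  have key : ∀ y : ι → M, {z | Sum.elim (Sum.elim (fun i => (c i : M)) y) z ∈
      {x | x ∘ (Equiv.sumAssoc _ _ _).symm ∈ D₀}} = {z : Fin k → M | Sum.elim y z ∈ D} := by
    intro y
    ext z
    rw [Set.mem_ofPred_eq, Set.mem_ofPred_eq, Set.mem_ofPred_eq, h]
    convert Iff.rfl using 2
    funext i
    rcases i with i | i | i <;> simp
  refine ⟨{y | Sum.elim (fun i => (c i : M)) y ∈ E}, ⟨r, c, E, hE, fun _ => Iff.rfl⟩,
    fun y hy => h1 _ (by rwa [key]), fun y hy => ?_⟩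
  rw [← key]
  exact h2 _ hy

end

theorem IsDef.isDefinable {A : Set M} {n : ℕ} {D : Set (Fin n → M)} (h : 𝔐.IsDef A D) :
    𝔐.IsDefinable A D := by
  obtain ⟨q, c, D₀, h₀, h⟩ := h
  obtain ⟨φ, hφ⟩ := h₀.exists_formula finSumFinEquiv
  refine ⟨⟨q, φ, c⟩, ?_⟩
  ext x
  rw [h, ← append_comp_finSumFinEquiv, hφ]
  rfl

theorem IsDefinable.isDef {A : Set M} {n : ℕ} {D : Set (Fin n → M)} (h : 𝔐.IsDefinable A D) :
    𝔐.IsDef A D := by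
  obtain ⟨⟨q, φ, c⟩, rfl⟩ := h
  refine ⟨q, c, {x | 𝔐.Sat φ (x ∘ finSumFinEquiv.symm)}, ⟨_, φ, _, fun _ => Iff.rfl⟩, fun x => ?_⟩
  rw [Set.mem_ofPred_eq, ← append_comp_finSumFinEquiv]
  simp [Function.comp_assoc, defSet]

theorem IsDef.mem_algebra (h𝔐 : 𝔐.IsStructure) {A : Set M} {n : ℕ} (hn : 0 < n)
    {D : Set (Fin n → M)} (h : 𝔐.IsDef A D) : D ∈ 𝔐.𝓑 n := by
  obtain ⟨φ, rfl⟩ := h.isDefinable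
  exact h𝔐 _ _ n hn φ.formula le_rfl _

theorem IsDef.mem_iff_of_tp_eq {A : Set M} {n : ℕ} {b b' : Fin n → M} (hb : 𝔐.tp b A = 𝔐.tp b' A)
    {D : Set (Fin n → M)} (h : 𝔐.IsDef A D) : b ∈ D ↔ b' ∈ D := by
  obtain ⟨φ, rfl⟩ := h.isDefinable
  exact Set.ext_iff.1 hb φ

/-- A nonempty set definable over an elementary substructure has a point in it. -/
theorem IsDef.exists_mem_of_elementary {N : L.Substructure M} {𝔑 : QuasiStructure L N}
    (helem : 𝔑.IsElementarySubstructure 𝔐) {n : ℕ} {D : Set (Fin n → M)}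
    (h : 𝔐.IsDef (N : Set M) D) (hD : D.Nonempty) : ∃ c : Fin n → N, (fun i => (c i : M)) ∈ D := by
  obtain ⟨⟨q, φ, c⟩, rfl⟩ := h.isDefinable
  obtain ⟨x, hx⟩ := hD
  have h1 := (helem.2 q (φ.exs n) c).2 ((𝔐.sat_exs n φ _).2 ⟨x, hx⟩)
  obtain ⟨y, hy⟩ := (𝔑.sat_exs n φ _).1 h1
  refine ⟨y, ?_⟩
  have h2 := (helem.2 _ _ _).1 hy
  have e : (fun i => ((Fin.append c y i : N) : M)) =
      Fin.append (fun i => (c i : M)) (fun i => (y i : M)) := by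
    funext i
    refine Fin.addCases (fun i => ?_) (fun i => ?_) i <;> simp
  rw [e] at h2
  exact h2

theorem IsDef.biInter {A : Set M} {ι κ : Type*} {D : κ → Set (ι → M)} (h : ∀ i, 𝔐.IsDef A (D i))
    (s : Finset κ) : 𝔐.IsDef A (⋂ i ∈ s, D i) := by
  classical
  induction s using Finset.induction_on with
  | empty => simpa using IsDef.univ
  | insert i s _ ih =>
    rw [Finset.set_biInter_insert]
    exact (h i).inter ih

theorem toReal_ratValue (q : ℚ≥0) : (ratValue q).toReal = q := rfl

/-- The measure of the fibres of a definable set varies little on a definable neighbourhood of each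
point. -/
theorem IsDef.exists_nhds {A : Set M} {ι : Type*} [Finite ι] {k : ℕ} (hk : 0 < k)
    {D : Set (ι ⊕ Fin k → M)} (h : 𝔐.IsDef A D)
    (hfin : ∀ y : ι → M, 𝔐.μ k {z | Sum.elim y z ∈ D} ≠ ⊤) (y₀ : ι → M) {τ : ℝ} (hτ : 0 < τ) :
    ∃ E, 𝔐.IsDef A E ∧ y₀ ∈ E ∧ ∀ y ∈ E, |(𝔐.μ k {z | Sum.elim y z ∈ D}).toReal -
      (𝔐.μ k {z | Sum.elim y₀ z ∈ D}).toReal| ≤ τ := by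
  set m : (ι → M) → ℝ := fun y => (𝔐.μ k {z | Sum.elim y z ∈ D}).toReal with hm
  have hm0 : ∀ y, 0 ≤ m y := fun y => ENNReal.toReal_nonneg
  have hrat : ∀ q : ℚ≥0, ratValue q ≠ ⊤ := fun q => ENNReal.coe_ne_top
  have near : ∀ q : ℚ≥0, ∃ E, 𝔐.IsDef A E ∧ (∀ y, m y < q → y ∈ E) ∧ ∀ y ∈ E, m y ≤ q := by
    intro q
    obtain ⟨E, hE, h1, h2⟩ := h.exists_meas hk q
    refine ⟨E, hE, fun y hy => h1 y ?_, fun y hy => ?_⟩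
    · rwa [← ENNReal.toReal_lt_toReal (hfin y) (hrat q), toReal_ratValue]
    · have := (ENNReal.toReal_le_toReal (hfin y) (hrat q)).2 (h2 y hy)
      rwa [toReal_ratValue] at this
  have exq : ∀ s t : ℝ, 0 ≤ s → s < t → ∃ q : ℚ≥0, s < q ∧ (q : ℝ) < t := by
    intro s t hs hst
    obtain ⟨q, h1, h2⟩ := exists_rat_btwn hst
    have hq : (0 : ℚ) ≤ q := by exact_mod_cast hs.trans h1.le
    exact ⟨⟨q, hq⟩, h1, h2⟩
  obtain ⟨q, hq1, hq2⟩ := exq (m y₀) (m y₀ + τ) (hm0 _) (by linarith)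
  obtain ⟨E, hE, h1, h2⟩ := near q
  -- When m y₀ ≤ τ the lower bound is automatic; otherwise a nonnegative rational fits between m y₀
  -- - τ and m y₀.
  rcases le_or_gt (m y₀) τ with hle | hlt
  · refine ⟨E, hE, h1 _ hq1, fun y hy => abs_le.2 ⟨?_, ?_⟩⟩
    · linarith [hm0 y]
    · linarith [h2 y hy]
  · obtain ⟨r, hr1, hr2⟩ := exq (m y₀ - τ) (m y₀) (by linarith) (by linarith)
    obtain ⟨E', hE', h1', h2'⟩ := near r
    refine ⟨E ∩ E'ᶜ, hE.inter hE'.compl, ⟨h1 _ hq1, fun h' => ?_⟩, fun y hy => abs_le.2 ⟨?_, ?_⟩⟩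
    · linarith [h2' _ h']
    · have : (r : ℝ) ≤ m y := not_lt.1 fun h' => hy.2 (h1' y h')
      linarith
    · linarith [h2 y hy.1]

theorem univ_mem (𝔐 : QuasiStructure L M) {n : ℕ} (hn : 0 < n) : Set.univ ∈ 𝔐.𝓑 n := by
  simpa using 𝔐.compl_mem n hn _ (𝔐.empty_mem n hn)

theorem μ_univ_lt_top (hfin : 𝔐.μ 1 Set.univ < ⊤) {n : ℕ} (hn : 0 < n) :
    𝔐.μ n Set.univ < ⊤ := by
  induction n, hn using Nat.le_induction with
  | base => exact hfin
  | succ n hn ih =>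
    have h := 𝔐.μ_rect n 1 hn one_pos _ (𝔐.univ_mem hn) _ (𝔐.univ_mem one_pos)
    have e : rect (Set.univ : Set (Fin n → M)) (Set.univ : Set (Fin 1 → M)) = Set.univ := by
      ext x; simp [rect]
    rw [e] at h
    rw [h]
    exact ENNReal.mul_lt_top ih hfin

theorem μ_ne_top (hfin : 𝔐.μ 1 Set.univ < ⊤) {n : ℕ} (hn : 0 < n) {B : Set (Fin n → M)}
    (hB : B ∈ 𝔐.𝓑 n) : 𝔐.μ n B ≠ ⊤ := by
  have h := 𝔐.μ_union n hn B hB Bᶜ (𝔐.compl_mem n hn B hB) disjoint_compl_right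
  rw [Set.union_compl_self] at h
  have h2 := μ_univ_lt_top hfin hn
  rw [h] at h2
  exact (ENNReal.add_lt_top.1 h2).1.ne

/-- The measure on `M^n` of a quasistructure of finite measure, with real values. -/
noncomputable def finMeas (𝔐 : QuasiStructure L M) (hfin : 𝔐.μ 1 Set.univ < ⊤) (n : ℕ)
    (hn : 0 < n) : FinMeas (Fin n → M) where
  sets := 𝔐.𝓑 n
  val A := (𝔐.μ n A).toReal
  empty_mem := 𝔐.empty_mem n hn
  compl_mem := 𝔐.compl_mem n hn
  union_mem := 𝔐.union_mem n hn
  nonneg _ := ENNReal.toReal_nonneg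
  val_empty := by rw [𝔐.μ_empty n hn, ENNReal.toReal_zero]
  val_union A hA B hB h := by
    rw [𝔐.μ_union n hn A hA B hB h,
      ENNReal.toReal_add (μ_ne_top hfin hn hA) (μ_ne_top hfin hn hB)]

/-- The point y is absorbed into the parameters, which may come from all of M. -/
theorem IsDef.fibre_mem_algebra (h𝔐 : 𝔐.IsStructure) {A : Set M} {j k : ℕ} (hk : 0 < k)
    {D : Set (Fin j ⊕ Fin k → M)} (h : 𝔐.IsDef A D) (y : Fin j → M) :
    {z | Sum.elim y z ∈ D} ∈ 𝔐.𝓑 k :=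
  ((h.mono (Set.subset_univ A)).subst fun i => ⟨y i, trivial⟩).mem_algebra h𝔐 hk

/-- The type of `b` over an elementary substructure is a limit of types of points of the
substructure. -/
theorem exists_ultrafilter {N : L.Substructure M} {𝔑 : QuasiStructure L N}
    (helem : 𝔑.IsElementarySubstructure 𝔐) {n : ℕ} (b : Fin n → M) :
    ∃ U : Ultrafilter (Fin n → M), {c | ∀ i, c i ∈ N} ∈ U ∧
      ∀ D, 𝔐.IsDef (N : Set M) D → b ∈ D → D ∈ U := by
  let F : Filter (Fin n → M) :=
    { sets := {T | ∃ D, 𝔐.IsDef (N : Set M) D ∧ b ∈ D ∧ D ∩ {c | ∀ i, c i ∈ N} ⊆ T}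
      univ_sets := ⟨_, IsDef.univ, trivial, Set.subset_univ _⟩
      sets_of_superset := fun ⟨D, h1, h2, h3⟩ h => ⟨D, h1, h2, h3.trans h⟩
      inter_sets := fun ⟨D, h1, h2, h3⟩ ⟨D', h1', h2', h3'⟩ =>
        ⟨_, h1.inter h1', ⟨h2, h2'⟩, fun _ hx => ⟨h3 ⟨hx.1.1, hx.2⟩, h3' ⟨hx.1.2, hx.2⟩⟩⟩ }
  have hF : F.NeBot := by
    -- Properness is the Tarski–Vaught property: a definable set over N containing b has a point in
    -- N.
    refine ⟨fun hbot => ?_⟩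
    have hempty : ∅ ∈ F := Filter.empty_mem_iff_bot.2 hbot
    obtain ⟨D, h1, h2, h3⟩ := hempty
    obtain ⟨c, hc⟩ := h1.exists_mem_of_elementary helem ⟨b, h2⟩
    exact h3 ⟨hc, fun i => (c i).2⟩
  exact ⟨Ultrafilter.of F, Ultrafilter.of_le F ⟨_, IsDef.univ, trivial, fun _ h => h.2⟩,
    fun D h1 h2 => Ultrafilter.of_le F ⟨D, h1, h2, fun _ h => h.1⟩⟩

end QuasiStructure

end AML

/-! ### Measures of intersections of fibres. -/

namespace AML.QuasiStructure

variable {L : FirstOrder.Language.{u, v}} {M : Type w} [L.Structure M] {𝔐 : QuasiStructure L M}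

theorem IsDef.fibre_inter_fibre {A : Set M} {k m n : ℕ} {X : Set (Fin (k + m) → M)}
    {Y : Set (Fin (k + n) → M)} (hX : 𝔐.IsDef A X) (hY : 𝔐.IsDef A Y) :
    ∃ D : Set ((Fin m ⊕ Fin n) ⊕ Fin k → M), 𝔐.IsDef A D ∧
      ∀ x y, {z | Sum.elim (Sum.elim x y) z ∈ D} = fibre X x ∩ fibre Y y := by
  refine ⟨_, (hX.reindex (Fin.append Sum.inr fun j => Sum.inl (Sum.inl j))).inter
    (hY.reindex (Fin.append Sum.inr fun j => Sum.inl (Sum.inr j))), fun x y => ?_⟩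
  have e1 : ∀ z : Fin k → M, Sum.elim (Sum.elim x y) z ∘
      Fin.append Sum.inr (fun j : Fin m => Sum.inl (Sum.inl j)) = Fin.append z x := by
    intro z; funext i
    refine Fin.addCases (fun i => ?_) (fun i => ?_) i <;> simp
  have e2 : ∀ z : Fin k → M, Sum.elim (Sum.elim x y) z ∘
      Fin.append Sum.inr (fun j : Fin n => Sum.inl (Sum.inr j)) = Fin.append z y := by
    intro z; funext i
    refine Fin.addCases (fun i => ?_) (fun i => ?_) i <;> simp
  ext z
  simp only [Set.mem_ofPred_eq, Set.mem_inter_iff, e1, e2, fibre]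

/-- The fibres over `y` of a definable family indexed by the pairs `(x, y)`. -/
theorem IsDef.subst_right {A : Set M} {m n k : ℕ} {D : Set ((Fin m ⊕ Fin n) ⊕ Fin k → M)}
    (hD : 𝔐.IsDef A D) (c : Fin n → A) :
    ∃ D' : Set (Fin m ⊕ Fin k → M), 𝔐.IsDef A D' ∧
      ∀ x : Fin m → M, {z | Sum.elim x z ∈ D'} =
        {z | Sum.elim (Sum.elim x fun i => (c i : M)) z ∈ D} := by
  refine ⟨_, (hD.reindex (Sum.elim (Sum.elim (fun i => Sum.inr (Sum.inl i)) Sum.inl)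
    fun i => Sum.inr (Sum.inr i))).subst c, fun x => ?_⟩
  ext z
  simp only [Set.mem_ofPred_eq]
  convert Iff.rfl using 2
  funext i
  rcases i with (i | i) | i <;> rfl

/-- If `tp(a / N b)` is wide, then the measure of `X_a ∩ Y_b` is the limit of the measures of
`X_a ∩ Y_c` for points `c` of `N` tending to `b`. -/
theorem tendsto_μ_fibre_inter (h𝔐 : 𝔐.IsStructure) (hfin : 𝔐.μ 1 Set.univ < ⊤)
    {N : Set M} {k m n : ℕ} (hk : 0 < k) (hm : 0 < m)
    (a : Fin m → M) (b : Fin n → M) (hwide : 𝔐.IsWide (𝔐.tp a (N ∪ Set.range b)))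
    {X : Set (Fin (k + m) → M)} (hX : 𝔐.IsDef N X)
    {Y : Set (Fin (k + n) → M)} (hY : 𝔐.IsDef N Y)
    (U : Ultrafilter (Fin n → M)) (hU : {c | ∀ i, c i ∈ N} ∈ U)
    (hUb : ∀ D, 𝔐.IsDef N D → b ∈ D → D ∈ U) :
    Tendsto (fun c => (𝔐.μ k (fibre X a ∩ fibre Y c)).toReal) U
      (𝓝 (𝔐.μ k (fibre X a ∩ fibre Y b)).toReal) := by
  have fibre_mem : ∀ {j : ℕ} {X : Set (Fin (k + j) → M)}, 𝔐.IsDef N X → ∀ x,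
      fibre X x ∈ 𝔐.𝓑 k := by
    intro j X hX x
    have h := (hX.reindex (Fin.append Sum.inr Sum.inl)).fibre_mem_algebra h𝔐 hk x
    convert h using 1
    ext z
    rw [Set.mem_ofPred_eq, Set.mem_ofPred_eq, fibre, Set.mem_ofPred_eq]
    convert Iff.rfl using 2
    funext i
    refine Fin.addCases (fun i => ?_) (fun i => ?_) i <;> simp
  obtain ⟨D, hD, hDXY⟩ := hX.fibre_inter_fibre hY
  have hDfin : ∀ x y, 𝔐.μ k (fibre X x ∩ fibre Y y) ≠ ⊤ := fun x y =>
    μ_ne_top hfin hk ((𝔐.finMeas hfin k hk).inter_mem (fibre_mem hX x) (fibre_mem hY y))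
  refine (𝔐.finMeas hfin k hk).tendsto_val_inter (𝔐.finMeas hfin m hm) (fibre_mem hX)
    (fibre_mem hY) U hU a b fun p c hc τ hτ => ?_
  obtain ⟨E, hE, habE, hEτ⟩ := hD.exists_nhds hk
    (fun w => by
      rw [show w = Sum.elim (w ∘ Sum.inl) (w ∘ Sum.inr) from (Sum.elim_comp_inl_inr w).symm, hDXY]
      exact hDfin _ _) (Sum.elim a b) hτ
  have hθ : ∀ i, ∃ θ : Set (Fin m → M), 𝔐.IsDef N θ ∧ a ∈ θ ∧ ∀ x ∈ θ,
      |(𝔐.μ k (fibre X x ∩ fibre Y (c i))).toReal -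
        (𝔐.μ k (fibre X a ∩ fibre Y (c i))).toReal| ≤ τ := by
    intro i
    obtain ⟨D', hD', hD'D⟩ := hD.subst_right fun j => (⟨c i j, hc i j⟩ : N)
    obtain ⟨θ, h1, h2, h3⟩ := hD'.exists_nhds hk
      (fun x => by rw [hD'D, hDXY]; exact hDfin _ _) a hτ
    refine ⟨θ, h1, h2, fun x hx => ?_⟩
    have h4 := h3 x hx
    rwa [hD'D, hD'D, hDXY, hDXY] at h4
  choose θ hθd haθ hθτ using hθ
  -- S is definable over N since the c i lie in N; hence its fibre over b is definable over N and b,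
  -- and wideness applies.
  set S : Set (Fin n ⊕ Fin m → M) := {w | w ∘ Sum.swap ∈ E} ∩
    {w | w ∘ Sum.inr ∈ ⋂ i ∈ (Finset.univ : Finset (Fin p)), θ i} with hSdef
  have hS : 𝔐.IsDef N S := (hE.reindex Sum.swap).inter ((IsDef.biInter hθd _).reindex Sum.inr)
  have memS : ∀ x y, Sum.elim y x ∈ S ↔ Sum.elim x y ∈ E ∧ ∀ i, x ∈ θ i := by
    intro x y
    have e : Sum.elim y x ∘ Sum.swap = Sum.elim x y := by
      funext i; rcases i with i | i <;> rfl
    simp only [hSdef, Set.mem_inter_iff, Set.mem_ofPred_eq, e, Sum.elim_comp_inr,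
      Finset.mem_univ, Set.iInter_true, Set.mem_iInter]
  have hSmem : ∀ d, {x | Sum.elim d x ∈ S} ∈ 𝔐.𝓑 m := fun d => hS.fibre_mem_algebra h𝔐 hm d
  have hpos : 0 < 𝔐.μ m {x | Sum.elim b x ∈ S} := by
    obtain ⟨φ, hφ⟩ := ((hS.mono Set.subset_union_left).subst
      fun i => (⟨b i, Or.inr ⟨i, rfl⟩⟩ : (N ∪ Set.range b : Set M))).isDefinable
    change {x | Sum.elim b x ∈ S} = _ at hφ
    rw [hφ]
    refine hwide φ ?_
    change a ∈ 𝔐.defSet φ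
    rw [← hφ]
    exact (memS a b).2 ⟨habE, haθ⟩
  have hpos' : 0 < (𝔐.μ m {x | Sum.elim b x ∈ S}).toReal :=
    ENNReal.toReal_pos hpos.ne' (μ_ne_top hfin hm (hSmem b))
  -- On Ψ, which U contains, the fibres of S keep at least half of the measure of the fibre over b.
  obtain ⟨Ψ, hΨ, hbΨ, hΨε⟩ := hS.exists_nhds hm (fun y => μ_ne_top hfin hm (hSmem y)) b
    (half_pos hpos')
  refine ⟨fun d => {x | Sum.elim d x ∈ S}, hSmem, ⟨_, half_pos hpos', ?_⟩, fun d x hx => ⟨?_, ?_⟩⟩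
  · filter_upwards [hUb Ψ hΨ hbΨ] with d hd
    have := (abs_le.1 (hΨε d hd)).1
    change _ ≤ (𝔐.μ m {x | Sum.elim d x ∈ S}).toReal
    linarith
  · have h := hEτ _ ((memS x d).1 hx).1
    rwa [hDXY, hDXY] at h
  · exact fun i => hθτ i x (((memS x d).1 hx).2 i)

/-- Every definable neighbourhood of a' over A contains a, so the two measures differ by at most any
τ > 0. -/
theorem toReal_μ_eq_of_tp_eq (h𝔐 : 𝔐.IsStructure) (hfin : 𝔐.μ 1 Set.univ < ⊤) {A : Set M}
    {j k : ℕ} (hk : 0 < k) {D : Set (Fin j ⊕ Fin k → M)} (hD : 𝔐.IsDef A D)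
    {a a' : Fin j → M} (ha : 𝔐.tp a A = 𝔐.tp a' A) :
    (𝔐.μ k {z | Sum.elim a z ∈ D}).toReal = (𝔐.μ k {z | Sum.elim a' z ∈ D}).toReal := by
  rw [← sub_eq_zero, ← abs_nonpos_iff]
  refine le_of_forall_pos_le_add fun τ hτ => ?_
  obtain ⟨E, hE, haE, hEτ⟩ := hD.exists_nhds hk
    (fun y => μ_ne_top hfin hk (hD.fibre_mem_algebra h𝔐 hk y)) a' hτ
  rw [zero_add]
  exact hEτ a ((hE.mem_iff_of_tp_eq ha).2 haE)

end AML.QuasiStructure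

open AML.QuasiStructure in
theorem mainTheorem8 {L : FirstOrder.Language.{u, v}} [Countable L.Symbols]
    {M : Type w} [L.Structure M]
    (𝔐 : AML.QuasiStructure L M) (h𝔐 : 𝔐.IsStructure)
    (hsat : 𝔐.IsAlephOneSaturated) (hfin : 𝔐.μ 1 Set.univ < ⊤)
    (N : L.Substructure M) (hN : (N : Set M).Countable)
    (𝔑 : AML.QuasiStructure L N) (h𝔑 : 𝔑.IsStructure)
    (helem : 𝔑.IsElementarySubstructure 𝔐)
    {k m n : ℕ} (hk : 0 < k) (hm : 0 < m) (hn : 0 < n)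
    (a a' : Fin m → M) (b b' : Fin n → M)
    (ha : 𝔐.tp a (N : Set M) = 𝔐.tp a' (N : Set M))
    (hb : 𝔐.tp b (N : Set M) = 𝔐.tp b' (N : Set M))
    (hwide : 𝔐.IsWide (𝔐.tp a ((N : Set M) ∪ Set.range b)))
    (hwide' : 𝔐.IsWide (𝔐.tp a' ((N : Set M) ∪ Set.range b')))
    (X : Set (Fin (k + m) → M)) (hX : 𝔐.IsDefinable (N : Set M) X)
    (Y : Set (Fin (k + n) → M)) (hY : 𝔐.IsDefinable (N : Set M) Y) :
    0 < 𝔐.μ k (AML.fibre X a ∩ AML.fibre Y b) ↔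
      0 < 𝔐.μ k (AML.fibre X a' ∩ AML.fibre Y b') := by
  replace hX := hX.isDef
  replace hY := hY.isDef
  obtain ⟨U, hU, hUb⟩ := exists_ultrafilter helem b
  have h1 := tendsto_μ_fibre_inter h𝔐 hfin hk hm a b hwide hX hY U hU hUb
  -- The same U converges to b', because b and b' lie in the same sets definable over N.
  have h2 := tendsto_μ_fibre_inter h𝔐 hfin hk hm a' b' hwide' hX hY U hU
    fun D hD hbD => hUb D hD ((hD.mem_iff_of_tp_eq hb).2 hbD)
  obtain ⟨D, hD, hDXY⟩ := hX.fibre_inter_fibre hY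
  have hmem : ∀ (x : Fin m → M) (y : Fin n → M), AML.fibre X x ∩ AML.fibre Y y ∈ 𝔐.𝓑 k := by
    intro x y
    obtain ⟨D', hD', hD'D⟩ := (hD.mono (Set.subset_univ _)).subst_right
      fun j => (⟨y j, trivial⟩ : (Set.univ : Set M))
    rw [← hDXY, ← hD'D]
    exact hD'.fibre_mem_algebra h𝔐 hk x
  have heq : ∀ᶠ c in (U : Filter (Fin n → M)), (𝔐.μ k (AML.fibre X a ∩ AML.fibre Y c)).toReal =
      (𝔐.μ k (AML.fibre X a' ∩ AML.fibre Y c)).toReal := by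
    filter_upwards [hU] with c hc
    obtain ⟨D', hD', hD'D⟩ := hD.subst_right fun j => (⟨c j, hc j⟩ : (N : Set M))
    have h := toReal_μ_eq_of_tp_eq h𝔐 hfin hk hD' ha
    rwa [hD'D, hD'D, hDXY, hDXY] at h
  have h3 := tendsto_nhds_unique (h1.congr' heq) h2
  rw [ENNReal.toReal_eq_toReal_iff' (μ_ne_top hfin hk (hmem a b))
    (μ_ne_top hfin hk (hmem a' b'))] at h3
  rw [h3]
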